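/- Let $G$ be a locally compact Hausdorff group with a Haar measure $dx$ (left invariant, Radon), let $H$ be a compact subgroup of $G$ with normalized Haar measure $dh$ (total mass $1$), and let $m$ be the normalized $G$-invariant measure on the space $G/H$ of left cosets, that is, the $G$-invariant positive Radon measure satisfying Weil's formula $$\int_{G/H}\Big(\int_H f(xh)\,dh\Big)\,dm(xH)=\int_G f(x)\,dx\qquad (f\in C_c(G)).$$ Let $\varphi:\mathbb R\to[0,\infty]$ be a Young function: $\varphi$ is nonzero, convex, even, left continuous on $[0,\infty)$, $\varphi(0)=0$ and $\lim_{x\to\infty}\varphi(x)=\infty$ (left continuity at $0$ meaning $\varphi(x)\to0$ as $x\uparrow0$). Suppose that $\varphi$ satisfies the $\Delta_2$-condition: there are $C>0$ and $x_0>0$ such that $\varphi(2x)\le C\varphi(x)$ for all $x\ge x_0$ if $m(G/H)<\infty$, and for all $x\ge 0$ otherwise. For a measurable $u:G/H\to\mathbb C$ write $u\in L^\varphi(G/H,m)$ if $\int_{G/H}\varphi(a|u|)\,dm<\infty$ for some $a>0$, and let $$\|u\|^0_{L^\varphi(G/H,m)}=\inf\Big\{k>0:\int_{G/H}\varphi\Big(\frac{|u|}{k}\Big)\,dm\le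 1\Big\}.$$ For $f,g\in C_c(G/H)$ (complex valued, continuous, with compact support) put $$Jg(xH)=\int_H g(hxH)\,dh,\qquad (f*_{G/H}g)(xH)=\int_{G/H}f(yH)\,Jg(y^{-1}xH)\,dm(yH).$$ Then for all $f,g\in C_c(G/H)$ the integral defining $f*_{G/H}g$ converges absolutely at every point of $G/H$, $f*_{G/H}g\in L^\varphi(G/H,m)$, and $$\|f*_{G/H}g\|^0_{L^\varphi(G/H,m)}\le\|f\|_{L^1(G/H,m)}\,\|g\|^0_{L^\varphi(G/H,m)}.$$ -/

import Mathlib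

open MeasureTheory Filter Topology
open scoped NNReal ENNReal CompactlySupported

namespace OrliczCoset

noncomputable section

/-! ### Young functions and Orlicz spaces -/

/-- Young functions: nonzero convex even functions `φ : ℝ → [0, ∞]` with `φ 0 = 0` and
`φ x → ∞` as `x → ∞`, left continuous. Left continuity is asked at the points of `[0, ∞)` only,
so that a jump to the value `∞` is allowed; at `0` it amounts to continuity, `φ` being even. -/
structure IsYoung (φ : ℝ → ℝ≥0∞) : Prop where
  ne_zero : φ ≠ 0
  convex : ConvexOn ℝ≥0 Set.univ φ
  even : ∀ x, φ (-x) = φ x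
  map_zero : φ 0 = 0
  left_cont : ∀ x, 0 ≤ x → ContinuousWithinAt φ (Set.Iic x) x
  tendsto_top : Tendsto φ atTop (𝓝 ∞)

section Orlicz

variable {Ω : Type*} [MeasurableSpace Ω]

/-- The `Δ₂`-condition with respect to the measure `m`: for large arguments if `m` is finite, for
all nonnegative arguments otherwise. -/
def DeltaTwo (φ : ℝ → ℝ≥0∞) (m : Measure Ω) : Prop :=
  ∃ C : ℝ≥0, 0 < C ∧ ∃ x₀ : ℝ, 0 < x₀ ∧
    (m Set.univ < ∞ → ∀ x, x₀ ≤ x → φ (2 * x) ≤ C * φ x) ∧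
    (m Set.univ = ∞ → ∀ x, 0 ≤ x → φ (2 * x) ≤ C * φ x)

/-- The modular `ρ_φ(f) = ∫ φ(|f|) dm`. -/
def modular (φ : ℝ → ℝ≥0∞) (m : Measure Ω) (f : Ω → ℂ) : ℝ≥0∞ :=
  ∫⁻ x, φ ‖f x‖ ∂m

/-- Membership in the Orlicz space `L^φ(Ω, m)`. -/
def MemOrlicz (φ : ℝ → ℝ≥0∞) (m : Measure Ω) (f : Ω → ℂ) : Prop :=
  AEStronglyMeasurable f m ∧ ∃ a : ℝ, 0 < a ∧ modular φ m (fun x => (a : ℂ) * f x) < ∞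

/-- The Luxemburg norm `inf {k > 0 : ∫ φ(|f| / k) dm ≤ 1}`, with values in `[0, ∞]`
(the infimum of the empty set being `∞`). -/
def luxemburgNorm (φ : ℝ → ℝ≥0∞) (m : Measure Ω) (f : Ω → ℂ) : ℝ≥0∞ :=
  ⨅ (k : ℝ) (_ : 0 < k) (_ : modular φ m (fun x => f x / (k : ℂ)) ≤ 1), ENNReal.ofReal k

end Orlicz

/-! ### Coset spaces of compact subgroups -/

section Coset

variable {G : Type*} [Group G] [TopologicalSpace G] [IsTopologicalGroup G]
  [MeasurableSpace G] [BorelSpace G]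

/-- The normalized Haar measure `dh` of the compact group `H`. -/
def normHaar (H : Subgroup G) [CompactSpace H] : Measure H :=
  Measure.haarMeasure ⊤

instance (H : Subgroup G) [CompactSpace H] : (normHaar H).IsHaarMeasure := by
  unfold normHaar; infer_instance

instance (H : Subgroup G) [CompactSpace H] : IsProbabilityMeasure (normHaar H) :=
  ⟨by simpa [normHaar] using
    Measure.haarMeasure_self (K₀ := (⊤ : TopologicalSpace.PositiveCompacts H))⟩

theorem integral_normHaar_mul_left (H : Subgroup G) [CompactSpace H] (F : H → ℂ) (k : H) :
    ∫ h, F (k * h) ∂(normHaar H) = ∫ h, F h ∂(normHaar H) :=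
  integral_mul_left_eq_self F k

theorem integral_normHaar_mul_right (H : Subgroup G) [CompactSpace H] (F : H → ℂ) (k : H) :
    ∫ h, F (h * k) ∂(normHaar H) = ∫ h, F h ∂(normHaar H) := by
  have : (Measure.map (· * k) (normHaar H)).IsHaarMeasure := Measure.isHaarMeasure_map_mul_right _ k
  have : IsProbabilityMeasure (Measure.map (· * k) (normHaar H)) :=
    Measure.isProbabilityMeasure_map (measurable_mul_const k).aemeasurable
  have e : Measure.map (· * k) (normHaar H) = normHaar H :=
    Measure.isHaarMeasure_eq_of_isProbabilityMeasure _ _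
  conv_rhs => rw [← e]
  exact ((MeasurableEquiv.mulRight k).measurableEmbedding.integral_map _).symm

/-- `T_H f (xH) = ∫_H f(xh) dh`. -/
def TH (H : Subgroup G) [CompactSpace H] (f : G → ℂ) (z : G ⧸ H) : ℂ :=
  Quotient.liftOn' z (fun x => ∫ h : H, f (x * h) ∂(normHaar H)) (by
    intro a b hab
    rw [QuotientGroup.leftRel_apply] at hab
    have := integral_normHaar_mul_left H (fun h => f (a * h)) ⟨a⁻¹ * b, hab⟩
    simpa [mul_assoc] using this.symm)

/-- `J g (xH) = ∫_H g(hxH) dh`. -/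
def J (H : Subgroup G) [CompactSpace H] (g : G ⧸ H → ℂ) (z : G ⧸ H) : ℂ :=
  ∫ h : H, g ((h : G) • z) ∂(normHaar H)

theorem J_smul (H : Subgroup G) [CompactSpace H] (g : G ⧸ H → ℂ) (k : H) (z : G ⧸ H) :
    J H g ((k : G) • z) = J H g z := by
  have := integral_normHaar_mul_right H (fun h => g ((h : G) • z)) k
  simpa [J, mul_smul] using this

/-- The map `yH ↦ J g (y⁻¹ • z)`, well defined since `J g` is invariant under `H`. -/
def JKernel (H : Subgroup G) [CompactSpace H] (g : G ⧸ H → ℂ) (z y : G ⧸ H) : ℂ :=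
  Quotient.liftOn' y (fun a => J H g (a⁻¹ • z)) (by
    intro a b hab
    rw [QuotientGroup.leftRel_apply] at hab
    have := J_smul H g ⟨a⁻¹ * b, hab⟩ (b⁻¹ • z)
    simpa [smul_smul] using this)

variable {H : Subgroup G} [CompactSpace H] [MeasurableSpace (G ⧸ H)]

/-- The convolution on the coset space:
`(f * g)(xH) = ∫_{G/H} f(yH) J g(y⁻¹xH) dm(yH)`. -/
def conv (m : Measure (G ⧸ H)) (f g : G ⧸ H → ℂ) (z : G ⧸ H) : ℂ :=
  ∫ y, f y * JKernel H g z y ∂m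

/-- `m` is the normalized `G`-invariant measure on `G ⧸ H`, with respect to the Haar measure `μ`
of `G`: the (unique) `G`-invariant positive Radon measure that satisfies Weil's formula
`∫_{G/H} T_H f dm = ∫_G f dμ` for `f ∈ C_c(G)`. -/
structure IsNormalizedInvariant (μ : Measure G) (m : Measure (G ⧸ H)) : Prop where
  regular : m.Regular
  invariant : SMulInvariantMeasure G (G ⧸ H) m
  weil : ∀ f : C_c(G, ℂ), ∫ z, TH H f z ∂m = ∫ x, f x ∂μ

end Coset

end

end OrliczCoset

/-! The inequality is Jensen twice plus invariance. Let `N = ‖f‖₁ > 0`. Then `|f * g| / N` is at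
most the mean of `|J g (y⁻¹ z)|` against the probability density `|f| / N`, and `|J g|` is at most
the mean of `|g|` over an `H`-orbit. Applying a convex increasing `ψ`, exchanging integrals and
using invariance of `m` gives `∫ ψ(|f * g| / N) ≤ ∫ ψ(|g|)`: this is `integral_J_norm_le` and
`integral_conv_norm_le`.

Two obstacles remain. First, `m` need not be σ-finite, so Fubini is used only for continuous
integrands of compact support on the product (`hasCompactSupport_mul_JKernel`). Second, `φ` may take
the value `∞`. If `g / k` has finite modular and `k < k'`, then `|g| / k'` stays in some `[0, c]`
strictly inside the region where `φ` is finite, because `m` charges nonempty open sets. There `φ`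
can be replaced by a continuous real `ψ`. The slack `k < k'` disappears in the infimum defining the
norm. -/

namespace OrliczCoset

/-! ### Young functions inside their domain of finiteness -/

section Young

variable {φ : ℝ → ℝ≥0∞}

theorem IsYoung.mono (hφ : IsYoung φ) {s t : ℝ} (hs : 0 ≤ s) (hst : s ≤ t) : φ s ≤ φ t := by
  rcases hs.eq_or_lt with rfl | hs
  · simp [hφ.map_zero]
  have ht : 0 < t := hs.trans_le hst
  obtain ⟨a, ha⟩ : ∃ a : ℝ≥0, (a : ℝ) = s / t :=
    ⟨(s / t).toNNReal, by simp [hs.le, ht.le, div_nonneg]⟩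
  have ha1 : a ≤ 1 := by
    rw [← NNReal.coe_le_coe, ha]
    exact (div_le_one ht).2 hst
  have := hφ.convex.2 (Set.mem_univ t) (Set.mem_univ 0) (zero_le (a := a))
    (zero_le (a := 1 - a)) (add_tsub_cancel_of_le ha1)
  simp only [smul_zero, add_zero, hφ.map_zero, NNReal.smul_def, ha, smul_eq_mul,
    div_mul_cancel₀ s ht.ne'] at this
  refine this.trans ?_
  rw [ENNReal.smul_def, smul_eq_mul]
  exact mul_le_of_le_one_left zero_le (by exact_mod_cast ha1)

theorem IsYoung.map_abs (hφ : IsYoung φ) (x : ℝ) : φ |x| = φ x := by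
  rcases abs_choice x with h | h <;> rw [h]
  exact hφ.even x

/-- Left continuity at `0` controls small negative arguments, and evenness carries this to positive
ones. It rules out a jump to `∞` immediately after `0`. -/
theorem IsYoung.exists_pos_lt_top (hφ : IsYoung φ) : ∃ x, 0 < x ∧ φ x < ∞ := by
  have h := hφ.left_cont 0 le_rfl
  rw [ContinuousWithinAt, hφ.map_zero] at h
  have h1 : ∀ᶠ x in 𝓝[<] (0 : ℝ), φ x < 1 :=
    (h.mono_left (nhdsWithin_mono _ Set.Iio_subset_Iic_self)).eventually
      (gt_mem_nhds zero_lt_one)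
  obtain ⟨x, hx, hx0⟩ := (h1.and self_mem_nhdsWithin).exists
  exact ⟨-x, by simpa using hx0, by rw [hφ.even]; exact hx.trans ENNReal.one_lt_top⟩

theorem IsYoung.convexOn_toReal (hφ : IsYoung φ) {c : ℝ} (hc : φ c < ∞) :
    ConvexOn ℝ (Set.Ioo (-c) c) fun t => (φ t).toReal := by
  have fin : ∀ t ∈ Set.Ioo (-c) c, φ t ≠ ∞ := fun t ht => by
    rw [← hφ.map_abs]
    exact ((hφ.mono (abs_nonneg t) (abs_lt.2 ht).le).trans_lt hc).ne
  refine ⟨convex_Ioo _ _, fun x hx y hy a b ha hb hab => ?_⟩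
  lift a to ℝ≥0 using ha
  lift b to ℝ≥0 using hb
  have h := hφ.convex.2 (Set.mem_univ x) (Set.mem_univ y) (zero_le (a := a)) (zero_le (a := b))
    (by exact_mod_cast hab)
  simp only [NNReal.smul_def, ENNReal.smul_def, smul_eq_mul] at h ⊢
  have h2 := ENNReal.toReal_mono (ENNReal.add_ne_top.2
    ⟨ENNReal.mul_ne_top ENNReal.coe_ne_top (fin x hx),
      ENNReal.mul_ne_top ENNReal.coe_ne_top (fin y hy)⟩) h
  rw [ENNReal.toReal_add (ENNReal.mul_ne_top ENNReal.coe_ne_top (fin x hx))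
    (ENNReal.mul_ne_top ENNReal.coe_ne_top (fin y hy))] at h2
  simpa using h2

/-- On an interval `[0, c]` strictly inside its domain of finiteness, a Young function agrees with
a continuous real-valued function that is monotone and convex there. -/
theorem IsYoung.exists_continuous_eq (hφ : IsYoung φ) {c c' : ℝ} (hc : 0 ≤ c) (hcc : c < c')
    (hc' : φ c' < ∞) :
    ∃ ψ : ℝ → ℝ, Continuous ψ ∧ ψ 0 = 0 ∧ (∀ t, 0 ≤ ψ t) ∧ MonotoneOn ψ (Set.Icc 0 c) ∧
      ConvexOn ℝ (Set.Icc 0 c) ψ ∧ ∀ t ∈ Set.Icc 0 c, φ t = ENNReal.ofReal (ψ t) := by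
  have hconv := hφ.convexOn_toReal hc'
  have hcont := hconv.continuousOn isOpen_Ioo
  have e : Set.EqOn (fun t => (φ t).toReal) (fun t => (φ (min |t| c)).toReal) (Set.Icc 0 c) :=
    fun t ht => by simp [abs_of_nonneg ht.1, min_eq_left ht.2]
  have fin : ∀ t ∈ Set.Icc 0 c, φ t ≠ ∞ := fun t ht =>
    ((hφ.mono ht.1 (ht.2.trans hcc.le)).trans_lt hc').ne
  have sub : Set.Icc 0 c ⊆ Set.Ioo (-c') c' := fun t ht =>
    ⟨by linarith [ht.1], ht.2.trans_lt hcc⟩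
  -- Clamping the argument to `[0, c]` extends the function continuously to all of `ℝ`.
  refine ⟨fun t => (φ (min |t| c)).toReal, ?_, by simp [hc, hφ.map_zero], fun t => by simp,
    ?_, (hconv.subset sub (convex_Icc _ _)).congr e, fun t ht => ?_⟩
  · exact hcont.comp_continuous (by fun_prop) fun t =>
      sub ⟨le_min (abs_nonneg t) hc, min_le_right _ _⟩
  · refine MonotoneOn.congr (fun s hs t ht hst => ?_) e
    exact ENNReal.toReal_mono (fin t ht) (hφ.mono hs.1 hst)
  · rw [← e ht, ENNReal.ofReal_toReal (fin t ht)]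

end Young

section Jensen

/-- Jensen's inequality for an integral against a density of total mass one. -/
theorem map_integral_smul_le {Y : Type*} [MeasurableSpace Y] {ν : Measure Y} {c : ℝ} {ψ : ℝ → ℝ}
    (hψ : Continuous ψ) (hconv : ConvexOn ℝ (Set.Icc 0 c) ψ) {ρ : Y → ℝ≥0} (hρ : Measurable ρ)
    (hρ1 : ∫⁻ y, ρ y ∂ν = 1) {u : Y → ℝ} (hu : ∀ y, u y ∈ Set.Icc 0 c)
    (hui : Integrable (fun y => ρ y • u y) ν) (hψu : Integrable (fun y => ρ y • ψ (u y)) ν) :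
    ψ (∫ y, ρ y • u y ∂ν) ≤ ∫ y, ρ y • ψ (u y) ∂ν := by
  have : IsProbabilityMeasure (ν.withDensity fun y => (ρ y : ℝ≥0∞)) :=
    ⟨by rw [withDensity_apply _ MeasurableSet.univ, setLIntegral_univ, hρ1]⟩
  rw [← integral_withDensity_eq_integral_smul hρ, ← integral_withDensity_eq_integral_smul hρ]
  exact hconv.map_integral_le hψ.continuousOn isClosed_Icc (ae_of_all _ hu)
    ((integrable_withDensity_iff_integrable_smul hρ).2 hui)
    ((integrable_withDensity_iff_integrable_smul hρ).2 hψu)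

end Jensen

/-! ### Parametric integrals with jointly compact support -/

section ParametricIntegral

variable {X Y E : Type*} [TopologicalSpace X] [TopologicalSpace Y] [MeasurableSpace Y]
  [OpensMeasurableSpace Y] [NormedAddCommGroup E] [NormedSpace ℝ E] {ν : Measure Y}

theorem continuous_integral_of_hasCompactSupport [IsFiniteMeasureOnCompacts ν] {F : X → Y → E}
    (hF : Continuous F.uncurry) (hF' : HasCompactSupport F.uncurry) :
    Continuous fun x => ∫ y, F x y ∂ν := by
  rw [← continuousOn_univ]
  refine continuousOn_integral_of_compact_support (hF'.image continuous_snd) hF.continuousOn ?_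
  intro x y _ hy
  by_contra h
  exact hy ⟨(x, y), subset_tsupport _ h, rfl⟩

omit [OpensMeasurableSpace Y] in
theorem hasCompactSupport_integral [R1Space X] {F : X → Y → E}
    (hF' : HasCompactSupport F.uncurry) : HasCompactSupport fun x => ∫ y, F x y ∂ν := by
  refine HasCompactSupport.intro (hF'.image continuous_fst) fun x hx => ?_
  have : ∀ y, F x y = 0 := fun y => by
    by_contra h
    exact hx ⟨(x, y), subset_tsupport _ h, rfl⟩
  simp [this]

omit [NormedSpace ℝ E] in
theorem integrable_of_hasCompactSupport_uncurry [IsFiniteMeasureOnCompacts ν] [R1Space Y]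
    {F : X → Y → E} (hF : Continuous F.uncurry) (hF' : HasCompactSupport F.uncurry) (x : X) :
    Integrable (F x) ν := by
  refine Continuous.integrable_of_hasCompactSupport (hF.comp (.prodMk_right x)) ?_
  refine HasCompactSupport.intro (hF'.image continuous_snd) fun y hy => ?_
  by_contra h
  exact hy ⟨(x, y), subset_tsupport _ h, rfl⟩

end ParametricIntegral

/-! ### Compactness and continuity on the coset space -/

section Coset

variable {G : Type*} [Group G] [TopologicalSpace G] [IsTopologicalGroup G] {H : Subgroup G}

/-- The quotient map is open, so images of compact neighbourhoods are neighbourhoods, and finitely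
many of them cover `K`. -/
theorem exists_isCompact_subset_image_mk [LocallyCompactSpace G] {K : Set (G ⧸ H)}
    (hK : IsCompact K) : ∃ A : Set G, IsCompact A ∧ K ⊆ (QuotientGroup.mk : G → G ⧸ H) '' A := by
  refine hK.induction_on ⟨∅, isCompact_empty, by simp⟩
    (fun s t hst ht => ht.imp fun A hA => ⟨hA.1, hst.trans hA.2⟩) ?_ fun x _ => ?_
  · rintro s t ⟨A, hA, hsA⟩ ⟨B, hB, htB⟩
    exact ⟨A ∪ B, hA.union hB, by rw [Set.image_union]; exact Set.union_subset_union hsA htB⟩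
  · obtain ⟨a, rfl⟩ := QuotientGroup.mk_surjective x
    obtain ⟨A, hA, haA⟩ := exists_compact_mem_nhds a
    exact ⟨_, mem_nhdsWithin_of_mem_nhds (QuotientGroup.isOpenMap_coe.image_mem_nhds haA), A, hA,
      subset_rfl⟩

variable [CompactSpace H]

theorem t2Space_quotient [T2Space G] : T2Space (G ⧸ H) :=
  have : IsClosed (H : Set G) := (isCompact_iff_compactSpace.2 ‹_›).isClosed
  inferInstance

variable [MeasurableSpace G] [BorelSpace G]

theorem continuous_J {g : G ⧸ H → ℂ} (hg : Continuous g) : Continuous (J H g) := by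
  rw [← continuousOn_univ]
  refine continuousOn_integral_of_compact_support (k := Set.univ) isCompact_univ ?_ (by simp)
  exact Continuous.continuousOn
    (by simp only [Function.uncurry_def]; fun_prop)

theorem JKernel_mk (g : G ⧸ H → ℂ) (z : G ⧸ H) (a : G) :
    JKernel H g z (a : G ⧸ H) = J H g (a⁻¹ • z) := rfl

theorem continuous_JKernel {g : G ⧸ H → ℂ} (hg : Continuous g) :
    Continuous fun p : (G ⧸ H) × (G ⧸ H) => JKernel H g p.1 p.2 := by
  -- Openness matters here: a product of open quotient maps is again a quotient map, so continuity
  -- can be tested on representatives.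
  rw [← (IsOpenQuotientMap.id.prodMap QuotientGroup.isOpenQuotientMap_mk).continuous_comp_iff]
  exact (continuous_J hg).comp (f := fun p : (G ⧸ H) × G => p.2⁻¹ • p.1) (by fun_prop)

theorem exists_mem_tsupport_of_J_ne_zero {g : G ⧸ H → ℂ} {z : G ⧸ H} (h : J H g z ≠ 0) :
    ∃ k : H, (k : G) • z ∈ tsupport g := by
  by_contra! hk
  exact h (by simp [J, fun k : H => image_eq_zero_of_notMem_tsupport (hk k)])

theorem norm_J_le {c : ℝ} {g : G ⧸ H → ℂ} (hc : ∀ z, ‖g z‖ ≤ c) (z : G ⧸ H) : ‖J H g z‖ ≤ c := by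
  simpa [J] using norm_integral_le_of_norm_le_const (μ := normHaar H)
    (ae_of_all _ fun h : H => hc ((h : G) • z))

theorem norm_JKernel_le {c : ℝ} {g : G ⧸ H → ℂ} (hc : ∀ z, ‖g z‖ ≤ c) (z y : G ⧸ H) :
    ‖JKernel H g z y‖ ≤ c := by
  obtain ⟨a, rfl⟩ := QuotientGroup.mk_surjective y
  exact norm_J_le hc _

/-- If the product is nonzero at `(z, aH)` with `a ∈ A`, then `k a⁻¹ z` lies in the support of `g`
for some `k ∈ H`. Hence `z` lies in the compact set `A · H · supp g`. -/
theorem hasCompactSupport_mul_JKernel [LocallyCompactSpace G] [T2Space (G ⧸ H)] {f g : G ⧸ H → ℂ}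
    (hf : HasCompactSupport f) (hg : HasCompactSupport g) :
    HasCompactSupport fun p : (G ⧸ H) × (G ⧸ H) => f p.2 * JKernel H g p.1 p.2 := by
  obtain ⟨A, hA, hfA⟩ := exists_isCompact_subset_image_mk hf.isCompact
  have hK : IsCompact ((fun q : G × H × (G ⧸ H) => (q.1 * ((q.2.1 : G))⁻¹) • q.2.2) ''
      (A ×ˢ Set.univ ×ˢ tsupport g)) :=
    (hA.prod (isCompact_univ.prod hg.isCompact)).image (by fun_prop)
  refine HasCompactSupport.intro (hK.prod hf.isCompact) fun p hp => ?_
  obtain ⟨z, y⟩ := p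
  by_contra h
  obtain ⟨hy, hJ⟩ := mul_ne_zero_iff.1 h
  have hy' : y ∈ tsupport f := subset_tsupport _ hy
  obtain ⟨a, haA, rfl⟩ := hfA hy'
  obtain ⟨k, hk⟩ := exists_mem_tsupport_of_J_ne_zero hJ
  refine hp ⟨⟨(a, k, (k : G) • (a : G)⁻¹ • z), ⟨haA, Set.mem_univ _, hk⟩, ?_⟩, hy'⟩
  simp [smul_smul]

end Coset

/-! ### Integral inequalities for `J` and the convolution -/

section Coset

variable {G : Type*} [Group G] [TopologicalSpace G] [IsTopologicalGroup G]
  [MeasurableSpace G] [BorelSpace G] {H : Subgroup G} [CompactSpace H]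
  [MeasurableSpace (G ⧸ H)] [BorelSpace (G ⧸ H)] [T2Space (G ⧸ H)] {m : Measure (G ⧸ H)}

/-- Jensen for the probability measure on `H`, then Fubini. Each inner integral over `G ⧸ H` is
independent of `h` by invariance of `m`. -/
theorem integral_J_norm_le [IsFiniteMeasureOnCompacts m] [SMulInvariantMeasure G (G ⧸ H) m]
    {c : ℝ} {ψ : ℝ → ℝ} (hψ : Continuous ψ) (hψ0 : ψ 0 = 0) (hmono : MonotoneOn ψ (Set.Icc 0 c))
    (hconv : ConvexOn ℝ (Set.Icc 0 c) ψ) {g : G ⧸ H → ℂ} (hg : Continuous g)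
    (hg' : HasCompactSupport g) (hc : ∀ z, ‖g z‖ ≤ c) :
    ∫ z, ψ ‖J H g z‖ ∂m ≤ ∫ z, ψ ‖g z‖ ∂m := by
  have hK : IsCompact ((fun q : H × (G ⧸ H) => ((q.1 : G))⁻¹ • q.2) ''
      (Set.univ ×ˢ tsupport g)) :=
    (isCompact_univ.prod hg'.isCompact).image (by fun_prop)
  let F : G ⧸ H → H → ℝ := fun z h => ψ ‖g ((h : G) • z)‖
  have hF : Continuous F.uncurry := by
    simp only [F, Function.uncurry_def]; fun_prop
  have hF' : HasCompactSupport F.uncurry := by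
    refine HasCompactSupport.intro (hK.prod isCompact_univ) fun p hp => ?_
    by_contra h
    refine hp ⟨⟨(p.2, (p.2 : G) • p.1), ⟨Set.mem_univ _, subset_tsupport _ fun h0 => h ?_⟩,
      by simp⟩, Set.mem_univ _⟩
    simp [F, Function.uncurry_def, h0, hψ0]
  have hJ : HasCompactSupport (J H g) := by
    refine HasCompactSupport.intro hK fun z hz => ?_
    by_contra h
    obtain ⟨k, hk⟩ := exists_mem_tsupport_of_J_ne_zero h
    exact hz ⟨(k, (k : G) • z), ⟨Set.mem_univ _, hk⟩, by simp⟩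
  have jensen (z) : ψ ‖J H g z‖ ≤ ∫ h, F z h ∂(normHaar H) := by
    have hi : Continuous fun h : H => ‖g ((h : G) • z)‖ := by fun_prop
    have hint {u : H → ℝ} (hu : Continuous u) : Integrable u (normHaar H) :=
      hu.integrable_of_hasCompactSupport (HasCompactSupport.of_compactSpace _)
    have h1 := norm_integral_le_integral_norm (μ := normHaar H) fun h : H => g ((h : G) • z)
    have h2 : ∫ h : H, ‖g ((h : G) • z)‖ ∂(normHaar H) ≤ c := by
      simpa using integral_mono (hint hi) (integrable_const c) fun h => hc _
    refine (hmono ⟨norm_nonneg _, norm_J_le hc z⟩ ⟨integral_nonneg fun _ => norm_nonneg _, h2⟩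
      h1).trans ?_
    exact hconv.map_integral_le hψ.continuousOn isClosed_Icc
      (ae_of_all _ fun h => ⟨norm_nonneg _, hc _⟩) (hint hi) (hint (hψ.comp hi))
  calc ∫ z, ψ ‖J H g z‖ ∂m ≤ ∫ z, ∫ h, F z h ∂(normHaar H) ∂m := by
        refine integral_mono ?_ ?_ jensen
        · exact (hψ.comp (continuous_J hg).norm).integrable_of_hasCompactSupport
            (hJ.comp_left (g := fun w => ψ ‖w‖) (by simpa using hψ0))
        · exact (continuous_integral_of_hasCompactSupport hF hF').integrable_of_hasCompactSupport
            (hasCompactSupport_integral hF')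
    _ = ∫ h : H, ∫ z, ψ ‖g ((h : G) • z)‖ ∂m ∂(normHaar H) :=
        integral_integral_swap_of_hasCompactSupport hF hF'
    _ = ∫ h : H, ∫ z, ψ ‖g z‖ ∂m ∂(normHaar H) := by
        congr 1 with h
        exact integral_smul_eq_self (μ := m) (fun z => ψ ‖g z‖) (g := (h : G))
    _ = ∫ z, ψ ‖g z‖ ∂m := by simp

theorem integral_JKernel_norm_le [IsFiniteMeasureOnCompacts m] [SMulInvariantMeasure G (G ⧸ H) m]
    {c : ℝ} {ψ : ℝ → ℝ} (hψ : Continuous ψ) (hψ0 : ψ 0 = 0) (hmono : MonotoneOn ψ (Set.Icc 0 c))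
    (hconv : ConvexOn ℝ (Set.Icc 0 c) ψ) {g : G ⧸ H → ℂ} (hg : Continuous g)
    (hg' : HasCompactSupport g) (hc : ∀ z, ‖g z‖ ≤ c) (y : G ⧸ H) :
    ∫ z, ψ ‖JKernel H g z y‖ ∂m ≤ ∫ z, ψ ‖g z‖ ∂m := by
  obtain ⟨a, rfl⟩ := QuotientGroup.mk_surjective y
  refine le_trans (le_of_eq ?_) (integral_J_norm_le hψ hψ0 hmono hconv hg hg' hc)
  exact integral_smul_eq_self (μ := m) (fun z => ψ ‖J H g z‖) (g := a⁻¹)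

variable [LocallyCompactSpace G]

omit [MeasurableSpace (G ⧸ H)] [BorelSpace (G ⧸ H)] [T2Space (G ⧸ H)] [LocallyCompactSpace G] in
theorem continuous_mul_JKernel {f g : G ⧸ H → ℂ} (hf : Continuous f) (hg : Continuous g) :
    Continuous fun p : (G ⧸ H) × (G ⧸ H) => f p.2 * JKernel H g p.1 p.2 :=
  (hf.comp continuous_snd).mul (continuous_JKernel hg)

theorem integrable_mul_JKernel [IsFiniteMeasureOnCompacts m] {f g : G ⧸ H → ℂ}
    (hf : Continuous f) (hf' : HasCompactSupport f) (hg : Continuous g)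
    (hg' : HasCompactSupport g) (z : G ⧸ H) : Integrable (fun y => f y * JKernel H g z y) m :=
  integrable_of_hasCompactSupport_uncurry (F := fun z y => f y * JKernel H g z y)
    (continuous_mul_JKernel hf hg) (hasCompactSupport_mul_JKernel hf' hg') z

theorem continuous_conv [IsFiniteMeasureOnCompacts m] {f g : G ⧸ H → ℂ}
    (hf : Continuous f) (hf' : HasCompactSupport f) (hg : Continuous g)
    (hg' : HasCompactSupport g) : Continuous (conv m f g) :=
  continuous_integral_of_hasCompactSupport (F := fun z y => f y * JKernel H g z y)
    (continuous_mul_JKernel hf hg) (hasCompactSupport_mul_JKernel hf' hg')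

omit [BorelSpace (G ⧸ H)] in
theorem hasCompactSupport_conv {f g : G ⧸ H → ℂ} (hf' : HasCompactSupport f)
    (hg' : HasCompactSupport g) : HasCompactSupport (conv m f g) :=
  hasCompactSupport_integral (F := fun z y => f y * JKernel H g z y)
    (hasCompactSupport_mul_JKernel hf' hg')

omit [T2Space (G ⧸ H)] [LocallyCompactSpace G] in
-- Keeps `‖f * g‖ / N` in `[0, c]`, where `φ` and its real substitute agree.
theorem norm_conv_le [IsFiniteMeasureOnCompacts m] {f g : G ⧸ H → ℂ} (hf : Continuous f)
    (hf' : HasCompactSupport f) {c : ℝ} (hc : ∀ z, ‖g z‖ ≤ c) (z : G ⧸ H) :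
    ‖conv m f g z‖ ≤ (∫ y, ‖f y‖ ∂m) * c := by
  rw [← integral_mul_const]
  refine norm_integral_le_of_norm_le
    ((hf.integrable_of_hasCompactSupport hf').norm.mul_const c) (ae_of_all _ fun y => ?_)
  rw [norm_mul]
  gcongr
  exact norm_JKernel_le hc z y

/-- Jensen against the density `ρ = |f| / N`. After the exchange of integrals, the inner integral is
bounded uniformly in `y`, and `ρ` integrates to `1`. -/
theorem integral_conv_norm_le [IsFiniteMeasureOnCompacts m] [SMulInvariantMeasure G (G ⧸ H) m]
    {c : ℝ} {ψ : ℝ → ℝ} (hψ : Continuous ψ) (hψ0 : ψ 0 = 0)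
    (hmono : MonotoneOn ψ (Set.Icc 0 c)) (hconv : ConvexOn ℝ (Set.Icc 0 c) ψ)
    {f g : G ⧸ H → ℂ} (hf : Continuous f) (hf' : HasCompactSupport f) (hN : 0 < ∫ y, ‖f y‖ ∂m) (hg : Continuous g)
    (hg' : HasCompactSupport g) (hc : ∀ z, ‖g z‖ ≤ c) :
    ∫ z, ψ (‖conv m f g z‖ / ∫ y, ‖f y‖ ∂m) ∂m ≤ ∫ z, ψ ‖g z‖ ∂m := by
  set N := ∫ y, ‖f y‖ ∂m with hNdef
  have hfi : Integrable f m := hf.integrable_of_hasCompactSupport hf'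
  let ρ : G ⧸ H → ℝ≥0 := fun y => ‖f y‖₊ / N.toNNReal
  have hρc : Continuous ρ := by fun_prop
  have hρ (y) : (ρ y : ℝ) = ‖f y‖ / N := by simp [ρ, hN.le]
  have hρi : Integrable (fun y => (ρ y : ℝ)) m := by
    simp only [hρ]; exact hfi.norm.div_const N
  have hρI : ∫ y, (ρ y : ℝ) ∂m = 1 := by
    simp only [hρ]; rw [integral_div, ← hNdef, div_self hN.ne']
  have hρ1 : ∫⁻ y, ρ y ∂m = 1 := by
    have := ofReal_integral_eq_lintegral_ofReal hρi (ae_of_all _ fun y => (ρ y).2)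
    simpa [hρI] using this.symm
  let F : G ⧸ H → G ⧸ H → ℝ := fun z y => ρ y • ψ ‖JKernel H g z y‖
  let F₁ : G ⧸ H → G ⧸ H → ℝ := fun z y => ρ y • ‖JKernel H g z y‖
  have hJc := continuous_JKernel (H := H) hg
  have hF : Continuous F.uncurry := by
    simp only [F, Function.uncurry_def]; fun_prop
  have hF₁ : Continuous F₁.uncurry := by
    simp only [F₁, Function.uncurry_def]; fun_prop
  have hsupp := hasCompactSupport_mul_JKernel (H := H) hf' hg'
  have hF' : HasCompactSupport F.uncurry := by
    refine hsupp.mono fun p hp h => hp ?_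
    rcases mul_eq_zero.1 h with h | h <;> simp [F, ρ, Function.uncurry_def, h, hψ0]
  have hF₁' : HasCompactSupport F₁.uncurry := by
    refine hsupp.mono fun p hp h => hp ?_
    rcases mul_eq_zero.1 h with h | h <;> simp [F₁, ρ, Function.uncurry_def, h]
  have jensen (z) : ψ (‖conv m f g z‖ / N) ≤ ∫ y, F z y ∂m := by
    have h1 : ‖conv m f g z‖ / N ≤ ∫ y, F₁ z y ∂m := by
      rw [div_le_iff₀ hN, ← integral_mul_const]
      refine (norm_integral_le_integral_norm _).trans (le_of_eq ?_)
      congr 1 with y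
      simp only [F₁, NNReal.smul_def, hρ, norm_mul, smul_eq_mul]
      field_simp
    have h2 : ∫ y, F₁ z y ∂m ≤ c := by
      calc ∫ y, F₁ z y ∂m ≤ ∫ y, (ρ y : ℝ) * c ∂m := by
            refine integral_mono (integrable_of_hasCompactSupport_uncurry hF₁ hF₁' z)
              (hρi.mul_const c) fun y => ?_
            exact mul_le_mul_of_nonneg_left (norm_JKernel_le hc z y) (ρ y).2
        _ = c := by rw [integral_mul_const, hρI, one_mul]
    have h0 : 0 ≤ ‖conv m f g z‖ / N := by positivity
    refine (hmono ⟨h0, h1.trans h2⟩ ⟨h0.trans h1, h2⟩ h1).trans ?_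
    exact map_integral_smul_le hψ hconv hρc.measurable hρ1
      (fun y => ⟨norm_nonneg _, norm_JKernel_le hc z y⟩)
      (integrable_of_hasCompactSupport_uncurry hF₁ hF₁' z)
      (integrable_of_hasCompactSupport_uncurry hF hF' z)
  have hswap : HasCompactSupport (fun y z => F z y).uncurry := by
    exact hF'.comp_homeomorph (Homeomorph.prodComm _ _)
  have hswapc : Continuous (fun y z => F z y).uncurry := hF.comp continuous_swap
  calc ∫ z, ψ (‖conv m f g z‖ / N) ∂m ≤ ∫ z, ∫ y, F z y ∂m ∂m := by
        refine integral_mono ?_ ?_ jensen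
        · have := continuous_conv (m := m) hf hf' hg hg'
          refine Continuous.integrable_of_hasCompactSupport (by fun_prop) ?_
          exact (hasCompactSupport_conv hf' hg').comp_left (g := fun w => ψ (‖w‖ / N))
            (by simpa using hψ0)
        · exact (continuous_integral_of_hasCompactSupport hF hF').integrable_of_hasCompactSupport
            (hasCompactSupport_integral hF')
    _ = ∫ y, ∫ z, F z y ∂m ∂m := integral_integral_swap_of_hasCompactSupport hF hF'
    _ ≤ ∫ y, (ρ y : ℝ) * ∫ z, ψ ‖g z‖ ∂m ∂m := by
        refine integral_mono ?_ (hρi.mul_const _) fun y => ?_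
        · exact (continuous_integral_of_hasCompactSupport hswapc
            hswap).integrable_of_hasCompactSupport (hasCompactSupport_integral hswap)
        · simp only [F, NNReal.smul_def, smul_eq_mul, integral_const_mul]
          exact mul_le_mul_of_nonneg_left
            (integral_JKernel_norm_le hψ hψ0 hmono hconv hg hg' hc y) (ρ y).2
    _ = ∫ z, ψ ‖g z‖ ∂m := by rw [integral_mul_const, hρI, one_mul]

omit [BorelSpace (G ⧸ H)] [T2Space (G ⧸ H)] [LocallyCompactSpace G] in
theorem conv_div_const (f g : G ⧸ H → ℂ) (k : ℂ) (z : G ⧸ H) :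
    conv m f (fun z => g z / k) z = conv m f g z / k := by
  have hJ (y : G ⧸ H) : JKernel H (fun z => g z / k) z y = JKernel H g z y / k := by
    obtain ⟨a, rfl⟩ := QuotientGroup.mk_surjective y
    simp only [JKernel_mk, J, integral_div]
  simp only [conv, hJ, ← mul_div_assoc, integral_div]

end Coset

/-! ### Modulars and the Luxemburg norm -/

section Orlicz

variable {φ : ℝ → ℝ≥0∞}

/-- A compactly supported continuous function of finite modular takes, after a contraction, its
values strictly inside the domain of finiteness of the Young function. -/
theorem IsYoung.exists_norm_le_of_modular_lt_top {X : Type*} [TopologicalSpace X]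
    [MeasurableSpace X] [OpensMeasurableSpace X] {m : Measure X} [m.IsOpenPosMeasure]
    (hφ : IsYoung φ) {g : X → ℂ} (hg : Continuous g) (hg' : HasCompactSupport g) {k k' : ℝ}
    (hk : 0 < k) (hkk : k < k') (h : modular φ m (fun x => g x / (k : ℂ)) < ∞) :
    ∃ c c' : ℝ, 0 ≤ c ∧ c < c' ∧ φ c' < ∞ ∧ ∀ x, ‖g x / (k' : ℂ)‖ ≤ c := by
  have hk' : 0 < k' := hk.trans hkk
  by_cases h0 : ∀ x, g x = 0
  · obtain ⟨x, hx, hφx⟩ := hφ.exists_pos_lt_top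
    exact ⟨0, x, le_rfl, hx, hφx, by simp [h0]⟩
  push Not at h0
  obtain ⟨x₁, hx₁⟩ := h0
  have : Nonempty X := ⟨x₁⟩
  obtain ⟨x₀, hx₀⟩ := hg.norm.exists_forall_ge_of_hasCompactSupport hg'.norm
  have hpos : 0 < ‖g x₀‖ := (norm_pos_iff.2 hx₁).trans_le (hx₀ x₁)
  have hlt : ‖g x₀‖ / k' < ‖g x₀‖ / k := div_lt_div_of_pos_left hpos hk hkk
  obtain ⟨c', hc1, hc2⟩ := exists_between hlt
  refine ⟨‖g x₀‖ / k', c', by positivity, hc1, ?_, fun x => ?_⟩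
  -- The maximum point of `|g|` lies in the open set `U`, so `m U > 0`. If `φ c' = ∞`, the modular
  -- would already be infinite on `U`.
  · let U : Set X := {x | c' < ‖g x‖ / k}
    have hU : IsOpen U := isOpen_lt continuous_const (by fun_prop)
    have hUpos : 0 < m U := hU.measure_pos m ⟨x₀, hc2⟩
    by_contra! htop
    refine h.not_ge ?_
    calc ∞ = ∞ * m U := (ENNReal.top_mul hUpos.ne').symm
      _ = ∫⁻ x in U, ∞ ∂m := (setLIntegral_const _ _).symm
      _ ≤ ∫⁻ x in U, φ ‖g x / (k : ℂ)‖ ∂m := by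
        refine setLIntegral_mono' hU.measurableSet fun x hx => htop.trans ?_
        refine hφ.mono ((by positivity : 0 ≤ ‖g x₀‖ / k').trans hc1.le) ?_
        simpa [abs_of_pos hk] using le_of_lt hx
      _ ≤ modular φ m (fun x => g x / (k : ℂ)) := setLIntegral_le_lintegral _ _
  · simp only [norm_div, Complex.norm_real, Real.norm_eq_abs, abs_of_pos hk']
    gcongr
    exact hx₀ x

theorem IsYoung.memOrlicz_of_hasCompactSupport {X : Type*} [TopologicalSpace X]
    [MeasurableSpace X] [OpensMeasurableSpace X] {m : Measure X} [IsFiniteMeasureOnCompacts m]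
    (hφ : IsYoung φ) {u : X → ℂ} (hu : Continuous u) (hu' : HasCompactSupport u) :
    MemOrlicz φ m u := by
  refine ⟨(hu.stronglyMeasurable_of_hasCompactSupport hu').aestronglyMeasurable, ?_⟩
  obtain ⟨x, hx, hφx⟩ := hφ.exists_pos_lt_top
  obtain ⟨C, hC⟩ := hu.bounded_above_of_compact_support hu'
  have hC' : 0 < max C 1 := lt_max_of_lt_right one_pos
  -- This factor brings `|u|` below `x`, where `φ` is finite. The maximum with `1` keeps the
  -- denominator positive.
  refine ⟨x / max C 1, by positivity, ?_⟩
  calc modular φ m (fun t => ((x / max C 1 : ℝ) : ℂ) * u t)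
      ≤ ∫⁻ t, (tsupport u).indicator (fun _ => φ x) t ∂m := by
        refine lintegral_mono fun t => ?_
        by_cases ht : t ∈ tsupport u
        · simp only [ht, Set.indicator_of_mem]
          refine hφ.mono (norm_nonneg _) ?_
          rw [norm_mul, Complex.norm_real, Real.norm_of_nonneg (by positivity), div_mul_eq_mul_div,
            div_le_iff₀ hC']
          gcongr
          exact (hC t).trans (le_max_left _ _)
        · simp [ht, image_eq_zero_of_notMem_tsupport ht, hφ.map_zero]
    _ = φ x * m (tsupport u) :=
        lintegral_indicator_const (isClosed_tsupport u).measurableSet _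
    _ < ∞ := ENNReal.mul_lt_top hφx hu'.isCompact.measure_lt_top

theorem luxemburgNorm_le {Ω : Type*} [MeasurableSpace Ω] {m : Measure Ω} {u : Ω → ℂ} {k : ℝ}
    (hk : 0 < k) (h : modular φ m (fun x => u x / (k : ℂ)) ≤ 1) :
    luxemburgNorm φ m u ≤ ENNReal.ofReal k :=
  iInf_le_of_le k (iInf_le_of_le hk (iInf_le _ h))

theorem luxemburgNorm_le_of_forall_lt {Ω : Type*} [MeasurableSpace Ω] {m : Measure Ω} {u : Ω → ℂ}
    {a : ℝ} (ha : 0 ≤ a) (h : ∀ k, a < k → modular φ m (fun x => u x / (k : ℂ)) ≤ 1) :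
    luxemburgNorm φ m u ≤ ENNReal.ofReal a := by
  have ht : Tendsto ENNReal.ofReal (𝓝[>] a) (𝓝 (ENNReal.ofReal a)) :=
    ENNReal.continuous_ofReal.continuousWithinAt
  refine ge_of_tendsto ht ?_
  filter_upwards [self_mem_nhdsWithin] with k hk
  exact luxemburgNorm_le (ha.trans_lt hk) (h k hk)

theorem luxemburgNorm_eq_zero_of_ae {Ω : Type*} [MeasurableSpace Ω] {m : Measure Ω}
    (hφ : IsYoung φ) {u : Ω → ℂ} (hu : u =ᵐ[m] 0) : luxemburgNorm φ m u = 0 := by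
  have := luxemburgNorm_le_of_forall_lt (φ := φ) (m := m) (u := u) le_rfl fun k _ => by
    have : modular φ m (fun x => u x / (k : ℂ)) = 0 := by
      refine (lintegral_congr_ae ?_).trans lintegral_zero
      filter_upwards [hu] with x hx
      simp [hx, hφ.map_zero]
    simp [this]
  simpa using this

end Orlicz

/-! ### The norm inequality -/

section Coset

variable {G : Type*} [Group G] [TopologicalSpace G] [IsTopologicalGroup G]
  [MeasurableSpace G] [BorelSpace G] {H : Subgroup G} [CompactSpace H]
  [MeasurableSpace (G ⧸ H)] [BorelSpace (G ⧸ H)] [T2Space (G ⧸ H)] {m : Measure (G ⧸ H)}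
  [LocallyCompactSpace G] [IsFiniteMeasureOnCompacts m] [SMulInvariantMeasure G (G ⧸ H) m]
  {φ : ℝ → ℝ≥0∞}

theorem IsYoung.modular_conv_div_le [m.IsOpenPosMeasure] (hφ : IsYoung φ) {f g : G ⧸ H → ℂ}
    (hf : Continuous f) (hf' : HasCompactSupport f) (hN : 0 < ∫ y, ‖f y‖ ∂m)
    (hg : Continuous g) (hg' : HasCompactSupport g) {k k' : ℝ} (hk : 0 < k) (hkk : k < k')
    (h : modular φ m (fun x => g x / (k : ℂ)) ≤ 1) :
    modular φ m (fun x => conv m f g x / ((((∫ y, ‖f y‖ ∂m) * k' : ℝ)) : ℂ)) ≤ 1 := by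
  obtain ⟨c, c', hc, hcc, hc', hbound⟩ :=
    hφ.exists_norm_le_of_modular_lt_top hg hg' hk hkk (h.trans_lt ENNReal.one_lt_top)
  obtain ⟨ψ, hψ, hψ0, hψn, hmono, hconv, hφψ⟩ := hφ.exists_continuous_eq hc hcc hc'
  set N := ∫ y, ‖f y‖ ∂m with hNdef
  have hk' : 0 < k' := hk.trans hkk
  have hgc : Continuous fun z => g z / (k' : ℂ) := by fun_prop
  have hgs : HasCompactSupport fun z => g z / (k' : ℂ) :=
    hg'.comp_left (g := fun w => w / (k' : ℂ)) (by simp)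
  have hle := integral_conv_norm_le hψ hψ0 hmono hconv hf hf' hN hgc hgs hbound
  have hcc := continuous_conv (m := m) hf hf' hgc hgs
  have hcs := hasCompactSupport_conv (m := m) hf' hgs
  have hcb := norm_conv_le (m := m) hf hf' hbound
  rw [← hNdef] at hle hcb
  have i1 : Integrable (fun z => ψ (‖conv m f (fun z => g z / (k' : ℂ)) z‖ / N)) m :=
    Continuous.integrable_of_hasCompactSupport (by fun_prop)
      (hcs.comp_left (g := fun w => ψ (‖w‖ / N)) (by simpa using hψ0))
  have i2 : Integrable (fun z => ψ ‖g z / (k' : ℂ)‖) m :=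
    Continuous.integrable_of_hasCompactSupport (by fun_prop)
      (hgs.comp_left (g := fun w => ψ ‖w‖) (by simpa using hψ0))
  calc modular φ m (fun x => conv m f g x / ((N * k' : ℝ) : ℂ))
      = ∫⁻ z, ENNReal.ofReal (ψ (‖conv m f (fun z => g z / (k' : ℂ)) z‖ / N)) ∂m := by
        refine lintegral_congr fun z => ?_
        rw [← hφψ]
        · simp only [conv_div_const, norm_div, Complex.norm_real, Real.norm_eq_abs, abs_mul,
            abs_of_pos hN, abs_of_pos hk']
          rw [div_div, mul_comm k']
        · exact ⟨by positivity, (div_le_iff₀ hN).2 (by simpa [mul_comm] using hcb z)⟩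
    _ = ENNReal.ofReal (∫ z, ψ (‖conv m f (fun z => g z / (k' : ℂ)) z‖ / N) ∂m) :=
        (ofReal_integral_eq_lintegral_ofReal i1 (ae_of_all _ fun _ => hψn _)).symm
    _ ≤ ENNReal.ofReal (∫ z, ψ ‖g z / (k' : ℂ)‖ ∂m) := ENNReal.ofReal_le_ofReal hle
    _ = ∫⁻ z, ENNReal.ofReal (ψ ‖g z / (k' : ℂ)‖) ∂m :=
        ofReal_integral_eq_lintegral_ofReal i2 (ae_of_all _ fun _ => hψn _)
    _ ≤ modular φ m (fun x => g x / (k : ℂ)) := by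
        refine lintegral_mono fun z => ?_
        rw [← hφψ _ ⟨norm_nonneg _, hbound z⟩]
        refine hφ.mono (norm_nonneg _) ?_
        simp only [norm_div, Complex.norm_real, Real.norm_eq_abs, abs_of_pos hk, abs_of_pos hk']
        gcongr
    _ ≤ 1 := h

theorem IsYoung.luxemburgNorm_conv_le [m.IsOpenPosMeasure] (hφ : IsYoung φ) {f g : G ⧸ H → ℂ}
    (hf : Continuous f) (hf' : HasCompactSupport f) (hg : Continuous g)
    (hg' : HasCompactSupport g) :
    luxemburgNorm φ m (conv m f g) ≤ eLpNorm f 1 m * luxemburgNorm φ m g := by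
  have hfi : Integrable f m := hf.integrable_of_hasCompactSupport hf'
  have hL1 : eLpNorm f 1 m = ENNReal.ofReal (∫ y, ‖f y‖ ∂m) := by
    rw [eLpNorm_one_eq_lintegral_enorm, ofReal_integral_norm_eq_lintegral_enorm hfi]
  have hN0 : 0 ≤ ∫ y, ‖f y‖ ∂m := integral_nonneg fun y => norm_nonneg (f y)
  -- The density `|f| / N` needs `N > 0`. If `N = 0`, then `f` vanishes almost everywhere and the
  -- convolution is identically zero.
  rcases hN0.eq_or_lt with hN | hN
  · have hf0 : f =ᵐ[m] 0 := by
      rw [← eLpNorm_eq_zero_iff hfi.aestronglyMeasurable one_ne_zero, hL1, ← hN,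
        ENNReal.ofReal_zero]
    have : conv m f g = 0 := by
      ext z
      refine integral_eq_zero_of_ae ?_
      filter_upwards [hf0] with y hy
      simp [hy]
    rw [luxemburgNorm_eq_zero_of_ae hφ (by rw [this])]
    exact zero_le
  · rw [hL1, luxemburgNorm]
    simp only [luxemburgNorm.eq_def φ m g,
      ENNReal.mul_iInf_of_ne (ENNReal.ofReal_pos.2 hN).ne' ENNReal.ofReal_ne_top]
    refine le_iInf fun k => le_iInf fun hk => le_iInf fun h => ?_
    rw [← ENNReal.ofReal_mul hN.le]
    -- Any `l > N k` has the form `N k'` with `k' = l / N > k`, which supplies the required slack.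
    refine luxemburgNorm_le_of_forall_lt (by positivity) fun l hl => ?_
    have := hφ.modular_conv_div_le hf hf' hN hg hg' hk
      ((lt_div_iff₀' hN).2 hl : k < l / ∫ y, ‖f y‖ ∂m) h
    rwa [mul_div_cancel₀ l hN.ne'] at this

end Coset

end OrliczCoset

theorem mainTheorem9 {G : Type*} [Group G] [TopologicalSpace G] [IsTopologicalGroup G]
    [LocallyCompactSpace G] [T2Space G] [MeasurableSpace G] [BorelSpace G]
    (μ : Measure G) [μ.IsHaarMeasure] [μ.Regular]
    (H : Subgroup G) [CompactSpace H]
    [MeasurableSpace (G ⧸ H)] [BorelSpace (G ⧸ H)]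
    (m : Measure (G ⧸ H)) (hm : OrliczCoset.IsNormalizedInvariant μ m)
    (φ : ℝ → ℝ≥0∞) (hφ : OrliczCoset.IsYoung φ) (hΔ : OrliczCoset.DeltaTwo φ m)
    (f g : C_c(G ⧸ H, ℂ)) :
    (∀ z : G ⧸ H, Integrable (fun y => f y * OrliczCoset.JKernel H g z y) m) ∧
    OrliczCoset.MemOrlicz φ m (OrliczCoset.conv m f g) ∧
    OrliczCoset.luxemburgNorm φ m (OrliczCoset.conv m f g) ≤
      eLpNorm f 1 m * OrliczCoset.luxemburgNorm φ m g := by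
  have : T2Space (G ⧸ H) := OrliczCoset.t2Space_quotient
  have : m.Regular := hm.regular
  have : SMulInvariantMeasure G (G ⧸ H) m := hm.invariant
  refine ⟨OrliczCoset.integrable_mul_JKernel f.continuous f.hasCompactSupport g.continuous
    g.hasCompactSupport, hφ.memOrlicz_of_hasCompactSupport
    (OrliczCoset.continuous_conv f.continuous f.hasCompactSupport g.continuous g.hasCompactSupport)
    (OrliczCoset.hasCompactSupport_conv f.hasCompactSupport g.hasCompactSupport), ?_⟩
  -- A nonzero regular measure invariant under the transitive action of `G` is positive on nonempty
  -- open sets. For `m = 0` the norm on the left is zero.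
  rcases eq_or_ne m 0 with h0 | h0
  · rw [OrliczCoset.luxemburgNorm_eq_zero_of_ae hφ (by rw [h0, ae_zero]; exact eventually_bot)]
    exact zero_le
  · have : m.IsOpenPosMeasure :=
      ⟨fun U hU hne => (measure_isOpen_pos_of_smulInvariant_of_ne_zero G h0 hU hne).ne'⟩
    exact hφ.luxemburgNorm_conv_le f.continuous f.hasCompactSupport g.continuous
      g.hasCompactSupport
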